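/- Let $n\ge 1$ be an integer. For $\delta>0$, $\beta\in\mathbb{R}\setminus\{n+4,n+6,n+8,\dots\}$ and $\nu\in\mathbb{R}^n$, let $$m^{\delta,\beta}(\nu)=-\|\nu\|^2\,{}_2F_3\!\left(1,\frac{n+2-\beta}{2};\,2,\frac{n+2}{2},\frac{n+4-\beta}{2};\,-\frac14\|\nu\|^2\delta^2\right)$$ be the Fourier multiplier of the nonlocal Laplace operator with horizon $\delta$ and kernel exponent $\beta$. Here $\|\cdot\|$ is the Euclidean norm, $${}_2F_3(a_1,a_2;b_1,b_2,b_3;z)=\sum_{k=0}^\infty\frac{(a_1)_k(a_2)_k}{(b_1)_k(b_2)_k(b_3)_k}\,\frac{z^k}{k!},$$ and $(x)_k=x(x+1)\cdots(x+k-1)$ is the rising factorial, with $(x)_0=1$. Then, for every fixed $\delta>0$ and every fixed $\nu\in\mathbb{R}^n$ with $\nu\neq 0$, the function $\beta\mapsto m^{\delta,\beta}(\nu)$ is strictly decreasing on the open interval $\left(\frac{n+4}{2},\,n+4\right)$. -/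

import Mathlib

/-- The generalized hypergeometric function `₂F₃(a₁, a₂; b₁, b₂, b₃; z)`, as the sum of its power
series `∑ₖ (a₁)ₖ (a₂)ₖ / ((b₁)ₖ (b₂)ₖ (b₃)ₖ) · zᵏ / k!`, where `(x)ₖ = x (x + 1) ⋯ (x + k - 1)` is
the rising factorial. The series converges for every real `z`; the function is meaningful as long
as none of `b₁, b₂, b₃` is a nonpositive integer. -/
noncomputable def hypergeometric2F3 (a₁ a₂ b₁ b₂ b₃ z : ℝ) : ℝ :=
  ∑' k : ℕ,
    ((ascPochhammer ℝ k).eval a₁ * (ascPochhammer ℝ k).eval a₂) /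
      ((ascPochhammer ℝ k).eval b₁ * (ascPochhammer ℝ k).eval b₂ * (ascPochhammer ℝ k).eval b₃) *
      (z ^ k / (k.factorial : ℝ))

/-- The Fourier multiplier `m^{δ,β}(ν)`, `ν ∈ ℝⁿ`, of the nonlocal Laplace operator with horizon
`δ` and kernel exponent `β`, in its hypergeometric form (for `β ≠ n + 4, n + 6, …`). -/
noncomputable def nonlocalMultiplier {n : ℕ} (δ β : ℝ) (ν : EuclideanSpace ℝ (Fin n)) : ℝ :=
  -‖ν‖ ^ 2 *
    hypergeometric2F3 1 (((n : ℝ) + 2 - β) / 2) 2 (((n : ℝ) + 2) / 2) (((n : ℝ) + 4 - β) / 2)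
      (-(1 / 4) * ‖ν‖ ^ 2 * δ ^ 2)

/-! Put a = (n+2-β)/2, c = (n+2)/2, t = ‖ν‖²δ²/4. Since (a)ₖ/(a+1)ₖ = a/(a+k), the difference of the
₂F₃ values at a < a' is (a'-a)t/c times the alternating series ∑ (-t)ʲ/((j+2)(a+1+j)(a'+1+j) j!
(c+1)ⱼ), so it suffices that this series is positive. Positivity starts from a square, ₀F₁(; p+1/2;
-t/4)² with 2p = c+1, and is carried along by averaging over dilations s ↦ ts against beta laws,
which multiplies the coefficients by (α)ⱼ/(α+β)ⱼ. One average yields the factor 1/(p+j); Beta(α,1)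
averages then supply each factor 1/(α+j). The endpoint β = (n+4)/2 is exactly a+1 = p. -/

/-! ### Rising factorials and Chu–Vandermonde -/

/-- The rising factorial `(x)ₖ = x (x + 1) ⋯ (x + k - 1)`. -/
noncomputable def risingFactorial (x : ℝ) (k : ℕ) : ℝ := (ascPochhammer ℝ k).eval x

namespace risingFactorial

theorem zero_right (x : ℝ) : risingFactorial x 0 = 1 := by simp [risingFactorial]

theorem succ (x : ℝ) (k : ℕ) :
    risingFactorial x (k + 1) = risingFactorial x k * (x + k) :=
  ascPochhammer_succ_eval k x

theorem add (x : ℝ) (i j : ℕ) :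
    risingFactorial x (i + j) = risingFactorial x i * risingFactorial (x + i) j := by
  induction j with
  | zero => simp [zero_right]
  | succ j ih => rw [← add_assoc, succ, ih, succ]; push_cast; ring

theorem succ_left (x : ℝ) (k : ℕ) :
    risingFactorial x (k + 1) = x * risingFactorial (x + 1) k := by
  rw [add_comm k 1, add, succ, zero_right]; simp

theorem pos {x : ℝ} (hx : 0 < x) (k : ℕ) : 0 < risingFactorial x k :=
  ascPochhammer_pos k x hx

theorem one_left (k : ℕ) : risingFactorial 1 k = k.factorial :=
  ascPochhammer_eval_one ℝ k

theorem two_left (k : ℕ) : risingFactorial 2 k = (k + 1).factorial := by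
  have h := succ_left 1 k
  rw [one_left, one_mul] at h
  rw [h]; norm_num

theorem mono {x y : ℝ} (hx : 0 < x) (hxy : x ≤ y) (k : ℕ) :
    risingFactorial x k ≤ risingFactorial y k := by
  induction k with
  | zero => simp [zero_right]
  | succ k ih =>
    rw [succ, succ]
    have := (pos hx k).le
    gcongr
    exact (pos (hx.trans_le hxy) k).le

theorem one_le {x : ℝ} (hx : 1 ≤ x) (k : ℕ) : 1 ≤ risingFactorial x k :=
  calc (1 : ℝ) ≤ k.factorial := by exact_mod_cast k.factorial_pos
    _ = risingFactorial 1 k := (one_left k).symm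
    _ ≤ risingFactorial x k := mono one_pos hx k

/-- Duplication formula. -/
theorem two_mul (x : ℝ) (k : ℕ) :
    risingFactorial (2 * x) (2 * k) =
      4 ^ k * risingFactorial x k * risingFactorial (x + 1 / 2) k := by
  induction k with
  | zero => simp [zero_right]
  | succ k ih =>
    rw [show 2 * (k + 1) = 2 * k + 1 + 1 by ring, succ, succ, ih, succ, succ]
    push_cast; ring

theorem div_succ_eq {x : ℝ} (hx : 0 < x) (k : ℕ) :
    risingFactorial x k / risingFactorial (x + 1) k = x / (x + k) := by
  have h1 := succ x k
  rw [succ_left] at h1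
  have : 0 < x + k := by positivity
  rw [div_eq_div_iff (pos (by linarith) k).ne' this.ne', ← h1]

theorem factorial_mul_choose (x : ℝ) (n : ℕ) :
    (n.factorial : ℝ) * Ring.choose (x + n - 1) n = risingFactorial x n := by
  rw [← Ring.multichoose_eq, ← nsmul_eq_mul, Ring.factorial_nsmul_multichoose_eq_ascPochhammer,
    Polynomial.ascPochhammer_smeval_eq_eval, risingFactorial]

theorem choose_eq {x : ℝ} (hx : 0 < x) (i j : ℕ) :
    Ring.choose (x + (i + j : ℕ) - 1) i =
      risingFactorial x (i + j) / (i.factorial * risingFactorial x j) := by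
  have h := factorial_mul_choose (x + j) i
  rw [show x + (j : ℝ) + i - 1 = x + (i + j : ℕ) - 1 by push_cast; ring] at h
  have h2 := pos hx j
  have h3 : (0 : ℝ) < i.factorial := by exact_mod_cast i.factorial_pos
  rw [eq_div_iff (by positivity), add_comm i j, add, ← h, add_comm j i]
  ring

/-- Chu–Vandermonde, in the form that gives the square of a confluent limit function `₀F₁`. -/
theorem sum_antidiagonal {p : ℝ} (hp : 0 < p) (k : ℕ) :
    ∑ ij ∈ Finset.HasAntidiagonal.antidiagonal k,
      1 / (ij.1.factorial * risingFactorial (p + 1 / 2) ij.1) *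
        (1 / (ij.2.factorial * risingFactorial (p + 1 / 2) ij.2)) =
      4 ^ k * risingFactorial p k /
        (k.factorial * risingFactorial (p + 1 / 2) k * risingFactorial (2 * p) k) := by
  set q := p + 1 / 2 with hq
  have hq0 : 0 < q := by positivity
  have hk := pos hq0 k
  have h2p := pos (show 0 < 2 * p by positivity) k
  have hf : (0 : ℝ) < k.factorial := by exact_mod_cast k.factorial_pos
  -- With i + j = k, C(q+k-1, i) = (q)ₖ/(i! (q)ⱼ), so each summand is a Vandermonde product divided
  -- by (q)ₖ².
  have key := Ring.add_choose_eq k (Commute.all (q + k - 1) (q + k - 1))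
  have hsum : ∑ ij ∈ Finset.HasAntidiagonal.antidiagonal k,
      1 / (ij.1.factorial * risingFactorial q ij.1) *
        (1 / (ij.2.factorial * risingFactorial q ij.2)) =
      (∑ ij ∈ Finset.HasAntidiagonal.antidiagonal k,
        Ring.choose (q + k - 1) ij.1 * Ring.choose (q + k - 1) ij.2) /
        risingFactorial q k ^ 2 := by
    rw [Finset.sum_div]
    refine Finset.sum_congr rfl fun ij hij => ?_
    obtain ⟨i, j⟩ := ij
    obtain rfl : i + j = k := by simpa using hij
    dsimp only
    have e2 := choose_eq hq0 j i
    rw [add_comm j i] at e2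
    rw [choose_eq hq0 i j, e2]
    have h1 := (pos hq0 i).ne'
    have h2 := (pos hq0 j).ne'
    have h3 := hk.ne'
    have h4 : (i.factorial : ℝ) ≠ 0 := by exact_mod_cast i.factorial_ne_zero
    have h5 : (j.factorial : ℝ) ≠ 0 := by exact_mod_cast j.factorial_ne_zero
    field_simp
  -- As 2q = 2p+1, the Vandermonde sum is (2p+k)ₖ/k!, and (2p)ₖ(2p+k)ₖ = (2p)₂ₖ is split by
  -- duplication.
  have hch := factorial_mul_choose (2 * p + k) k
  rw [show 2 * p + k + k - 1 = q + k - 1 + (q + k - 1) by rw [hq]; ring] at hch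
  have hdup := two_mul p k
  rw [_root_.two_mul k, add] at hdup
  rw [hsum, ← key, div_eq_div_iff (by positivity) (by positivity)]
  rw [← hch, ← hq] at hdup
  linear_combination risingFactorial q k * hdup

theorem Gamma_add_nat {x : ℝ} (hx : 0 < x) (k : ℕ) :
    Real.Gamma (x + k) = risingFactorial x k * Real.Gamma x := by
  induction k with
  | zero => simp [zero_right]
  | succ k ih =>
    have : x + k ≠ 0 := by positivity
    rw [succ, Nat.cast_succ, ← add_assoc, Real.Gamma_add_one this, ih]; ring

end risingFactorial

/-! ### Moments and support of beta distributions -/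

section BetaMoments

open MeasureTheory ProbabilityTheory

theorem integral_betaPDFReal {α β : ℝ} (hα : 0 < α) (hβ : 0 < β) :
    ∫ x, betaPDFReal α β x = 1 := by
  have h0 : 0 ≤ betaPDFReal α β := fun x => by
    by_cases hx : 0 < x ∧ x < 1
    · exact (betaPDFReal_pos hx.1 hx.2 hα hβ).le
    · simp [betaPDFReal, hx]
  rw [integral_eq_lintegral_of_nonneg_ae (Filter.Eventually.of_forall h0)
    (by fun_prop)]
  change (∫⁻ x, betaPDF α β x).toReal = 1
  rw [lintegral_betaPDF_eq_one hα hβ, ENNReal.toReal_one]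

theorem betaPDFReal_mul_pow {α β : ℝ} (hα : 0 < α) (hβ : 0 < β) (k : ℕ) (x : ℝ) :
    betaPDFReal α β x * x ^ k =
      risingFactorial α k / risingFactorial (α + β) k * betaPDFReal (α + k) β x := by
  unfold betaPDFReal
  split_ifs with hx
  · have e : x ^ (α + k - 1) = x ^ (α - 1) * x ^ k := by
      rw [← Real.rpow_add_natCast hx.1.ne']; ring_nf
    have hαβ : 0 < α + β := by positivity
    have h1 := (risingFactorial.pos hα k).ne'
    have h2 := (risingFactorial.pos hαβ k).ne'
    have h3 := (Real.Gamma_pos_of_pos hα).ne'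
    have h4 := (Real.Gamma_pos_of_pos hβ).ne'
    have h5 := (Real.Gamma_pos_of_pos hαβ).ne'
    rw [e, beta, beta, add_right_comm, risingFactorial.Gamma_add_nat hα,
      risingFactorial.Gamma_add_nat hαβ]
    field_simp
  · simp

theorem integral_pow_betaMeasure {α β : ℝ} (hα : 0 < α) (hβ : 0 < β) (k : ℕ) :
    ∫ x, x ^ k ∂(betaMeasure α β) = risingFactorial α k / risingFactorial (α + β) k := by
  have hm : Measurable (betaPDF α β) := (measurable_betaPDFReal α β).ennreal_ofReal
  rw [betaMeasure, integral_withDensity_eq_integral_toReal_smul hm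
    (Filter.Eventually.of_forall fun x => ENNReal.ofReal_lt_top)]
  have e : ∀ x, (betaPDF α β x).toReal • x ^ k =
      risingFactorial α k / risingFactorial (α + β) k * betaPDFReal (α + k) β x := fun x => by
    rw [← betaPDFReal_mul_pow hα hβ, smul_eq_mul, betaPDF, ENNReal.toReal_ofReal]
    by_cases hx : 0 < x ∧ x < 1
    · exact (betaPDFReal_pos hx.1 hx.2 hα hβ).le
    · simp [betaPDFReal, hx]
  simp_rw [e]
  rw [integral_const_mul, integral_betaPDFReal (by positivity) hβ, mul_one]

theorem ae_mem_Ioo_betaMeasure (α β : ℝ) : ∀ᵐ x ∂(betaMeasure α β), x ∈ Set.Ioo (0 : ℝ) 1 := by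
  have hm : Measurable (betaPDF α β) := (measurable_betaPDFReal α β).ennreal_ofReal
  rw [betaMeasure, ae_withDensity_iff hm]
  refine Filter.Eventually.of_forall fun x hx => ?_
  by_contra h
  refine hx ?_
  rw [betaPDF_eq, if_neg (by simpa using h), ENNReal.ofReal_zero]

theorem betaMeasure_Ioo_pos {α β ε : ℝ} (hα : 0 < α) (hβ : 0 < β) (hε : 0 < ε) :
    0 < betaMeasure α β (Set.Ioo 0 ε) := by
  have hm : Measurable (betaPDF α β) := (measurable_betaPDFReal α β).ennreal_ofReal
  rw [betaMeasure, withDensity_apply _ measurableSet_Ioo, setLIntegral_pos_iff hm]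
  refine lt_of_lt_of_le ?_ (measure_mono (s := Set.Ioo 0 (min ε 1)) ?_)
  · simp [hε]
  · intro x hx
    have h1 := lt_min_iff.1 hx.2
    exact ⟨(ENNReal.ofReal_pos.2 (betaPDFReal_pos hx.1 h1.2 hα hβ)).ne', hx.1, h1.1⟩

end BetaMoments

/-! ### Nonnegative entire series under beta averaging -/

/-- The power series with coefficients `a` is entire, positive at `0`, and nonnegative on
`[0, ∞)`. -/
structure EntireNonneg (a : ℕ → ℝ) : Prop where
  summable : ∀ t : ℝ, Summable fun j => |a j| * |t| ^ j
  zero_pos : 0 < a 0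
  nonneg : ∀ t : ℝ, 0 ≤ t → 0 ≤ ∑' j, a j * t ^ j

namespace EntireNonneg

open MeasureTheory ProbabilityTheory

variable {a : ℕ → ℝ}

theorem continuous_tsum (ha : EntireNonneg a) : Continuous fun t : ℝ => ∑' j, a j * t ^ j := by
  rw [continuous_iff_continuousAt]
  intro x
  have hon : ContinuousOn (fun t : ℝ => ∑' j, a j * t ^ j) (Metric.ball 0 (|x| + 1)) := by
    refine continuousOn_tsum (u := fun j => |a j| * |(|x| + 1)| ^ j)
      (fun j => by fun_prop) (ha.summable _) fun j t ht => ?_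
    rw [Metric.mem_ball, dist_zero_right, Real.norm_eq_abs] at ht
    rw [Real.norm_eq_abs, abs_mul, abs_pow, abs_of_pos (show 0 < |x| + 1 by positivity)]
    gcongr
  refine hon.continuousAt (Metric.isOpen_ball.mem_nhds ?_)
  simp

/-- Averaging a nonnegative entire function over dilations against a beta distribution. -/
theorem tsum_beta_pos (ha : EntireNonneg a) {α β : ℝ} (hα : 0 < α) (hβ : 0 < β)
    {t : ℝ} (ht : 0 ≤ t) :
    0 < ∑' j, a j * (risingFactorial α j / risingFactorial (α + β) j) * t ^ j := by
  set f : ℝ → ℝ := fun s => ∑' j, a j * (t * s) ^ j with hf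
  have hfc : Continuous f := ha.continuous_tsum.comp (continuous_const.mul continuous_id)
  have := isProbabilityMeasureBeta hα hβ
  set μ := betaMeasure α β with hμ
  have hae : ∀ᵐ s ∂μ, s ∈ Set.Ioo (0 : ℝ) 1 := ae_mem_Ioo_betaMeasure α β
  have hle : ∀ s ∈ Set.Ioo (0 : ℝ) 1, ∀ j, ‖a j * (t * s) ^ j‖ ≤ |a j| * |t| ^ j := by
    intro s hs j
    rw [Real.norm_eq_abs, abs_mul, abs_pow, abs_mul, abs_of_pos hs.1]
    have h0 : 0 ≤ |t| * s := mul_nonneg (abs_nonneg t) hs.1.le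
    gcongr
    exact mul_le_of_le_one_right (abs_nonneg t) hs.2.le
  have hsum : ∀ s ∈ Set.Ioo (0 : ℝ) 1, Summable fun j => ‖a j * (t * s) ^ j‖ := fun s hs =>
    (ha.summable t).of_nonneg_of_le (fun j => norm_nonneg _) (hle s hs)
  have hint : HasSum (fun j => ∫ s, a j * (t * s) ^ j ∂μ) (∫ s, f s ∂μ) := by
    refine hasSum_integral_of_dominated_convergence (fun j _ => |a j| * |t| ^ j)
      (fun j => (by fun_prop : Continuous fun s => a j * (t * s) ^ j).aestronglyMeasurable)
      (fun j => ?_) (Filter.Eventually.of_forall fun s => ha.summable t)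
      (integrable_const _) ?_
    · filter_upwards [hae] with s hs using hle s hs j
    · filter_upwards [hae] with s hs using (hsum s hs).of_norm.hasSum
  have hmom : ∀ j, ∫ s, a j * (t * s) ^ j ∂μ =
      a j * (risingFactorial α j / risingFactorial (α + β) j) * t ^ j := fun j => by
    simp_rw [mul_pow, ← mul_assoc]
    rw [integral_const_mul, integral_pow_betaMeasure hα hβ]; ring
  simp_rw [hmom] at hint
  rw [hint.tsum_eq]
  -- Strictness: `f` stays positive near 0, and the beta law charges every interval (0, ε).
  have hf0 : 0 < f 0 := by
    have : f 0 = a 0 := by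
      rw [hf]
      dsimp only
      rw [tsum_eq_single 0 fun j hj => by simp [hj]]
      simp
    rw [this]; exact ha.zero_pos
  have hnn : 0 ≤ᵐ[μ] f := by
    filter_upwards [hae] with s hs using ha.nonneg _ (mul_nonneg ht hs.1.le)
  have hfi : Integrable f μ := by
    refine Integrable.of_bound hfc.aestronglyMeasurable (∑' j, |a j| * |t| ^ j) ?_
    filter_upwards [hae] with s hs
    exact (norm_tsum_le_tsum_norm (hsum s hs)).trans
      ((hsum s hs).tsum_le_tsum (hle s hs) (ha.summable t))
  rw [integral_pos_iff_support_of_nonneg_ae hnn hfi]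
  obtain ⟨ε, hε, hball⟩ := Metric.eventually_nhds_iff.1 (hfc.continuousAt.eventually (lt_mem_nhds hf0))
  refine (betaMeasure_Ioo_pos hα hβ hε).trans_le (measure_mono fun s hs => ?_)
  refine ne_of_gt (hball ?_)
  rw [dist_zero_right, Real.norm_eq_abs, abs_of_pos hs.1]
  exact hs.2

theorem beta (ha : EntireNonneg a) {α β : ℝ} (hα : 0 < α) (hβ : 0 < β) :
    EntireNonneg fun j => a j * (risingFactorial α j / risingFactorial (α + β) j) where
  summable t := by
    refine (ha.summable t).of_nonneg_of_le (fun j => by positivity) fun j => ?_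
    have h1 := risingFactorial.pos hα j
    have h2 := risingFactorial.pos (show 0 < α + β by positivity) j
    rw [abs_mul, abs_of_pos (div_pos h1 h2)]
    gcongr
    refine mul_le_of_le_one_right (abs_nonneg _) ((div_le_one h2).2 ?_)
    exact risingFactorial.mono hα (by linarith) j
  zero_pos := by simpa [risingFactorial.zero_right] using ha.zero_pos
  nonneg _ ht := (ha.tsum_beta_pos hα hβ ht).le

/-- The case Beta(α, 1), where (α)ⱼ/(α+1)ⱼ telescopes. -/
theorem div_add (ha : EntireNonneg a) {α : ℝ} (hα : 0 < α) :
    EntireNonneg fun j => a j * (α / (α + j)) := by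
  simpa only [risingFactorial.div_succ_eq hα] using ha.beta hα one_pos

theorem tsum_div_add_pos (ha : EntireNonneg a) {α : ℝ} (hα : 0 < α) {t : ℝ} (ht : 0 ≤ t) :
    0 < ∑' j, a j * (α / (α + j)) * t ^ j := by
  simpa only [risingFactorial.div_succ_eq hα] using ha.tsum_beta_pos hα one_pos ht

theorem summable_mul (ha : EntireNonneg a) (t : ℝ) : Summable fun j => a j * t ^ j := by
  refine Summable.of_norm ((ha.summable t).congr fun j => ?_)
  rw [norm_mul, norm_pow, Real.norm_eq_abs, Real.norm_eq_abs]

end EntireNonneg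

/-! ### Positivity of the alternating series -/

/-- `₁F₂(p; p + 1/2, 2p; -t)` is the square of `₀F₁(; p + 1/2; -t/4)`. -/
theorem entireNonneg_square {p : ℝ} (hp : 1 / 2 ≤ p) :
    EntireNonneg fun k => (-1) ^ k * risingFactorial p k /
      (k.factorial * risingFactorial (p + 1 / 2) k * risingFactorial (2 * p) k) := by
  have hp0 : 0 < p := by linarith
  have hu : ∀ t : ℝ, Summable fun i : ℕ =>
      ‖(-t / 4) ^ i * (1 / (i.factorial * risingFactorial (p + 1 / 2) i))‖ := fun t => by
    refine (Real.summable_pow_div_factorial |t / 4|).of_nonneg_of_le (fun i => norm_nonneg _)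
      fun i => ?_
    have h1 := risingFactorial.one_le (show 1 ≤ p + 1 / 2 by linarith) i
    have h2 : 0 < risingFactorial (p + 1 / 2) i := by linarith
    rw [norm_mul, norm_pow, Real.norm_eq_abs, neg_div, abs_neg, div_eq_mul_one_div (|t / 4| ^ i),
      Real.norm_of_nonneg (by positivity)]
    gcongr
    exact le_mul_of_one_le_right (by positivity) h1
  have hprod : ∀ t : ℝ, ∀ k, ∑ ij ∈ Finset.HasAntidiagonal.antidiagonal k,
      (-t / 4) ^ ij.1 * (1 / (ij.1.factorial * risingFactorial (p + 1 / 2) ij.1)) *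
        ((-t / 4) ^ ij.2 * (1 / (ij.2.factorial * risingFactorial (p + 1 / 2) ij.2))) =
      (-1) ^ k * risingFactorial p k /
        (k.factorial * risingFactorial (p + 1 / 2) k * risingFactorial (2 * p) k) * t ^ k := by
    intro t k
    have : ∀ ij ∈ Finset.HasAntidiagonal.antidiagonal k,
      (-t / 4) ^ ij.1 * (1 / (ij.1.factorial * risingFactorial (p + 1 / 2) ij.1)) *
        ((-t / 4) ^ ij.2 * (1 / (ij.2.factorial * risingFactorial (p + 1 / 2) ij.2))) =
      (-t / 4) ^ k * (1 / (ij.1.factorial * risingFactorial (p + 1 / 2) ij.1) *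
        (1 / (ij.2.factorial * risingFactorial (p + 1 / 2) ij.2))) := fun ij hij => by
      rw [← Finset.HasAntidiagonal.mem_antidiagonal.1 hij, pow_add]; ring
    rw [Finset.sum_congr rfl this, ← Finset.mul_sum, risingFactorial.sum_antidiagonal hp0,
      div_pow, neg_pow]
    field_simp
  refine ⟨fun t => ?_, by simp [risingFactorial.zero_right], fun t _ => ?_⟩
  · have h := summable_norm_sum_mul_antidiagonal_of_summable_norm (hu t) (hu t)
    refine h.congr fun k => ?_
    rw [hprod, norm_mul, norm_pow, Real.norm_eq_abs, Real.norm_eq_abs]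
  · simp_rw [← hprod t]
    rw [← tsum_mul_tsum_eq_tsum_sum_antidiagonal_of_summable_norm (hu t) (hu t)]
    exact mul_self_nonneg _

/-- `₁F₂(p; p + 1, 2p; -t)`, a multiple of `∫₀ˣ J_{2p-1}`, is nonnegative. -/
theorem entireNonneg_bessel_integral {p : ℝ} (hp : 1 / 2 ≤ p) :
    EntireNonneg fun k : ℕ =>
      (-1) ^ k / (k.factorial * risingFactorial (2 * p) k) * (p / (p + k)) := by
  -- This law turns the denominator (p+1/2)ₖ into (p+1)ₖ, and (p)ₖ/(p+1)ₖ = p/(p+k).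
  have h := (entireNonneg_square hp).beta (α := p + 1 / 2) (β := 1 / 2) (by linarith)
    (by norm_num)
  convert h using 2 with k
  rw [← risingFactorial.div_succ_eq (by linarith), add_assoc p, show (1 / 2 + 1 / 2 : ℝ) = 1 by norm_num]
  have h1 := (risingFactorial.pos (show 0 < p + 1 / 2 by linarith) k).ne'
  generalize risingFactorial (p + 1 / 2) k = R at *
  field_simp

/-- The available factor is 1/(p+j), not 1/(b+j); they are linked by 1/(b+j) = 1/(p+j) +
(p-b)/((p+j)(b+j)), whose last coefficient is nonnegative because b ≤ p. -/
theorem tsum_main_pos {p b b' : ℝ} (hp2 : 1 / 2 ≤ p) (hb : 0 < b) (hbp : b ≤ p) (hb' : 0 < b')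
    {t : ℝ} (ht : 0 ≤ t) :
    0 < ∑' j : ℕ, (-1) ^ j / (((j : ℝ) + 2) * (b + j) * (b' + j) * j.factorial *
      risingFactorial (2 * p) j) * t ^ j := by
  have hp : 0 < p := hb.trans_le hbp
  have h2 := (entireNonneg_bessel_integral hp2).div_add two_pos
  have hM := h2.tsum_div_add_pos hb' ht
  have h3 := h2.div_add hb'
  have hN := h3.tsum_div_add_pos hb ht
  have key : ∀ j : ℕ, (-1) ^ j / (((j : ℝ) + 2) * (b + j) * (b' + j) * j.factorial *
      risingFactorial (2 * p) j) * t ^ j =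
      1 / (2 * p * b') * ((-1) ^ j / (j.factorial * risingFactorial (2 * p) j) * (p / (p + j)) *
        (2 / (2 + j)) * (b' / (b' + j)) * t ^ j) +
      (p - b) / (2 * p * b * b') * ((-1) ^ j / (j.factorial * risingFactorial (2 * p) j) *
        (p / (p + j)) * (2 / (2 + j)) * (b' / (b' + j)) * (b / (b + j)) * t ^ j) := fun j => by
    have h1 : p + j ≠ 0 := by positivity
    have h4 : b + j ≠ 0 := by positivity
    have h5 : b' + j ≠ 0 := by positivity
    have h6 : (j : ℝ) + 2 ≠ 0 := by positivity
    have h7 : (2 : ℝ) + j ≠ 0 := by positivity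
    have h8 := (risingFactorial.pos (show 0 < 2 * p by positivity) j).ne'
    field_simp
    ring
  simp_rw [key]
  rw [((h3.summable_mul t).mul_left _).tsum_add (((h3.div_add hb).summable_mul t).mul_left _),
    tsum_mul_left, tsum_mul_left]
  have : 0 ≤ (p - b) / (2 * p * b * b') := div_nonneg (by linarith) (by positivity)
  have : 0 < 1 / (2 * p * b') := by positivity
  positivity

/-! ### Monotonicity of the multiplier -/

/-- The terms of index `j + 1` of `₂F₃(1, a; 2, c, a + 1; -t)`. -/
noncomputable def multiplierTerm (a c t : ℝ) (j : ℕ) : ℝ :=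
  a / (a + 1 + j) * ((-t) ^ (j + 1) / ((j + 2).factorial * risingFactorial c (j + 1)))

theorem summable_multiplierTerm {a c : ℝ} (ha : -1 < a) (hc : 1 ≤ c) (t : ℝ) :
    Summable (multiplierTerm a c t) := by
  have h := (((summable_nat_add_iff 1).2 (Real.summable_pow_div_factorial |t|)).mul_left
    (|a| / (a + 1)))
  refine Summable.of_norm_bounded h fun j => ?_
  have h1 := risingFactorial.one_le hc (j + 1)
  have h2 : 0 < risingFactorial c (j + 1) := by linarith
  have h3 : 0 < a + 1 := by linarith
  rw [multiplierTerm, Real.norm_eq_abs, abs_mul, abs_div, abs_div, abs_pow, abs_neg,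
    abs_of_pos (show 0 < a + 1 + j by positivity),
    abs_of_pos (show 0 < (j + 2).factorial * risingFactorial c (j + 1) by positivity)]
  have h4 : ((j + 1).factorial : ℝ) ≤ (j + 2).factorial * risingFactorial c (j + 1) :=
    calc ((j + 1).factorial : ℝ) ≤ (j + 2).factorial := by
          exact_mod_cast Nat.factorial_le (by omega)
      _ ≤ _ := le_mul_of_one_le_right (by positivity) h1
  have h5 : a + 1 ≤ a + 1 + j := le_add_of_nonneg_right j.cast_nonneg
  exact mul_le_mul (div_le_div_of_nonneg_left (abs_nonneg a) h3 h5)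
    (div_le_div_of_nonneg_left (by positivity) (by positivity) h4) (by positivity) (by positivity)

theorem hypergeometric2F3_eq {a c : ℝ} (ha : -1 < a) (hc : 1 ≤ c) (t : ℝ) :
    hypergeometric2F3 1 a 2 c (a + 1) (-t) = 1 + ∑' j, multiplierTerm a c t j := by
  have hterm : ∀ j : ℕ, risingFactorial 1 (j + 1) * risingFactorial a (j + 1) /
      (risingFactorial 2 (j + 1) * risingFactorial c (j + 1) * risingFactorial (a + 1) (j + 1)) *
      ((-t) ^ (j + 1) / ((j + 1).factorial : ℝ)) = multiplierTerm a c t j := fun j => by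
    have h3 : 0 < a + 1 := by linarith
    have h1 := (risingFactorial.pos h3 j).ne'
    have h2 := (risingFactorial.pos (show 0 < c by linarith) (j + 1)).ne'
    have h4 : a + 1 + j ≠ 0 := by positivity
    have h5 : ((j + 1).factorial : ℝ) ≠ 0 := by positivity
    have h6 : ((j + 2).factorial : ℝ) ≠ 0 := by positivity
    -- Pulling a out of (a)ⱼ₊₁ leaves only (a+1)ⱼ to cancel, so a ≤ 0 is harmless.
    rw [risingFactorial.one_left, risingFactorial.two_left, risingFactorial.succ_left a,
      risingFactorial.succ (a + 1), multiplierTerm]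
    field_simp
  change ∑' k : ℕ, risingFactorial 1 k * risingFactorial a k /
      (risingFactorial 2 k * risingFactorial c k * risingFactorial (a + 1) k) *
      ((-t) ^ k / (k.factorial : ℝ)) = _
  rw [((summable_nat_add_iff 1).1
    ((summable_multiplierTerm ha hc t).congr fun j => (hterm j).symm)).tsum_eq_zero_add]
  simp_rw [hterm]
  simp [risingFactorial.zero_right]

theorem hypergeometric2F3_lt {a a' c t : ℝ} (ha : -1 < a) (haa' : a < a') (hac : a ≤ (c - 1) / 2)
    (hc : 1 ≤ c) (ht : 0 < t) :
    hypergeometric2F3 1 a' 2 c (a' + 1) (-t) < hypergeometric2F3 1 a 2 c (a + 1) (-t) := by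
  have ha' : -1 < a' := ha.trans haa'
  have hpos := tsum_main_pos (p := (c + 1) / 2) (b := a + 1) (b' := a' + 1) (by linarith)
    (by linarith) (by linarith) (by linarith) ht.le
  rw [hypergeometric2F3_eq ha hc, hypergeometric2F3_eq ha' hc, add_lt_add_iff_left, ← sub_pos,
    ← (summable_multiplierTerm ha hc t).tsum_sub (summable_multiplierTerm ha' hc t)]
  -- The numerator (a-a')(j+1) of the difference reduces (j+2)! to (j+2) j!.
  have key : ∀ j : ℕ, multiplierTerm a c t j - multiplierTerm a' c t j =
      (a' - a) * t / c * ((-1) ^ j / (((j : ℝ) + 2) * (a + 1 + j) * (a' + 1 + j) * j.factorial *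
      risingFactorial (2 * ((c + 1) / 2)) j) * t ^ j) := fun j => by
    have h1 : 0 < a + 1 := by linarith
    have h2 : 0 < a' + 1 := by linarith
    have h3 : a + 1 + j ≠ 0 := by positivity
    have h4 : a' + 1 + j ≠ 0 := by positivity
    have h5 := (risingFactorial.pos (show 0 < c + 1 by linarith) j).ne'
    have h6 : c ≠ 0 := by positivity
    have h7 : (j : ℝ) + 2 ≠ 0 := by positivity
    have h8 : (j : ℝ) + 1 ≠ 0 := by positivity
    rw [multiplierTerm, multiplierTerm, risingFactorial.succ_left, mul_div_cancel₀ _ two_ne_zero,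
      Nat.factorial_succ, Nat.factorial_succ, neg_pow]
    push_cast
    rw [show (j : ℝ) + 1 + 1 = j + 2 by ring]
    field_simp
    ring
  simp_rw [key]
  rw [tsum_mul_left]
  have : 0 < a' - a := by linarith
  positivity

theorem mainTheorem6 (n : ℕ) (hn : 1 ≤ n) (δ : ℝ) (hδ : 0 < δ)
    (ν : EuclideanSpace ℝ (Fin n)) (hν : ν ≠ 0) :
    StrictAntiOn (fun β : ℝ => nonlocalMultiplier δ β ν)
      (Set.Ioo (((n : ℝ) + 4) / 2) ((n : ℝ) + 4)) := by
  intro β hβ β' hβ' hlt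
  have hν0 : 0 < ‖ν‖ := norm_pos_iff.2 hν
  have hn0 : (0 : ℝ) ≤ n := n.cast_nonneg
  -- The parameter a decreases in β, so the larger exponent β' gives the smaller a.
  have h := hypergeometric2F3_lt (a := ((n : ℝ) + 2 - β') / 2) (a' := ((n : ℝ) + 2 - β) / 2)
    (c := ((n : ℝ) + 2) / 2) (t := 1 / 4 * ‖ν‖ ^ 2 * δ ^ 2) (by linarith [hβ'.2])
    (by linarith) (by linarith [hβ'.1]) (by linarith) (by positivity)
  have e : ∀ x : ℝ, ((n : ℝ) + 2 - x) / 2 + 1 = ((n : ℝ) + 4 - x) / 2 := fun x => by ring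
  rw [e, e, show -(1 / 4 * ‖ν‖ ^ 2 * δ ^ 2) = -(1 / 4) * ‖ν‖ ^ 2 * δ ^ 2 by ring] at h
  exact mul_lt_mul_of_neg_left h (neg_lt_zero.2 (by positivity))
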